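/- Let $S$ and $A$ be finite sets, $H\ge 1$ a horizon, $p_h(s,a,\cdot)$ ($h=0,\dots,H-1$) transition probabilities on $S$, $\beta$ an initial distribution on $S$, $r_h(s,a,s')$ and $r_H(s)$ single-stage and terminal rewards, and, for $k=1,\dots,M$, $g^{(k)}_h(s,a,s')$ and $g^{(k)}_H(s)$ single-stage and terminal constraint costs with thresholds $\alpha^{(k)}\in\mathbb{R}$. For $h=0,\dots,H-1$ and $\theta_h\in\mathbb{R}^{y_h}$ let $\mu_{\theta_h}(s,\cdot)$ be a probability distribution on $A$ with $\mu_{\theta_h}(s,a)>0$, twice continuously differentiable in $\theta_h$; put $\theta=(\theta_0,\dots,\theta_{H-1})$. Let $d^\theta_h(s)$ be the probability that the state at instant $h$ is $s$ when the initial state has law $\beta$ and the policy $(\mu_{\theta_h})_h$ is used, and $S_h=\{s: d^\theta_h(s)>0\}$ (which does not depend on $\theta$). Let $\phi_h(s)\in\mathbb{R}^{x_h}$, $h=0,\dots,H$, be feature vectors and $\Phi_h\in\mathbb{R}^{|S_h|\times x_h}$ the matrix with rows $\phi_h(s)^T$, $s\in S_h$; assume that the columns of each $\Phi_h$ are linearly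 independent. For $\lambda\in\mathbb{R}^M$ let $c^\lambda_h=r_h+\sum_k\lambda^{(k)}g^{(k)}_h$ for $h<H$ and $c^\lambda_H=r_H+\sum_k\lambda^{(k)}(g^{(k)}_H-\alpha^{(k)})$. Let $D^\theta_h=\mathrm{diag}(d^\theta_h(s))_{s\in S_h}$, let $P^\theta_h(s,s')=\sum_a\mu_{\theta_h}(s,a)p_h(s,a,s')$ for $s\in S_h$, $s'\in S_{h+1}$, and let $C^{\theta,\lambda}_h, G^{\theta,(k)}_h\in\mathbb{R}^{S_h}$ be the vectors with entries $\sum_a\mu_{\theta_h}(s,a)\sum_{s'}p_h(s,a,s')c(s,a,s')$ with $c=c^\lambda_h$, respectively $c=g^{(k)}_h$, for $h<H$, and $C^{\theta,\lambda}_H=(c^\lambda_H(s))_{s\in S_H}$, $G^{\theta,(k)}_H=(g^{(k)}_H(s)-\alpha^{(k)})_{s\in S_H}$. Define $$\Lambda_H=(\Phi_H^TD^\theta_H\Phi_H)^{-1}\Phi_H^TD^\theta_HC^{\theta,\lambda}_H,\qquad \Lambda_h=(\Phi_h^TD^\theta_h\Phi_h)^{-1}\big(\Phi_h^TD^\theta_hP^\theta_h\Phi_{h+1}\Lambda_{h+1}+\Phi_h^TD^\theta_hC^{\theta,\lambda}_h\big),\quad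 h=H-1,\dots,0,$$ and $\Xi^{(k)}_h$, $h=H,\dots,0$, by the same recursion with $G^{\theta,(k)}_h$ in place of $C^{\theta,\lambda}_h$. Let $a(n)>0$, $n\ge0$, with $\sum_na(n)=\infty$ and $\sum_na(n)^2<\infty$. Fix $\theta$ and $\lambda$, let $(s_0(n),a_0(n),s_1(n),\dots,a_{H-1}(n),s_H(n))$, $n\ge 0$, be independent episodes, each generated from $\beta$, $p_h$ and $\mu_{\theta_h}$, and, from arbitrary (possibly random) initial weights, let $$v_h(n+1)=v_h(n)+a(n)\big[c^\lambda_h(s_h(n),a_h(n),s_{h+1}(n))+v_{h+1}(n)^T\phi_{h+1}(s_{h+1}(n))-v_h(n)^T\phi_h(s_h(n))\big]\phi_h(s_h(n)),\quad h<H,$$ $$v_H(n+1)=v_H(n)+a(n)\big[c^\lambda_H(s_H(n))-v_H(n)^T\phi_H(s_H(n))\big]\phi_H(s_H(n)),$$ and let $w^{(k)}_h(n)$ follow the same recursions with $g^{(k)}_h$ ($h<H$) and $g^{(k)}_H-\alpha^{(k)}$ in place of $c^\lambda_h$ and $c^\lambda_H$. Then all the matrices $\Phi_h^TD^\theta_h\Phi_h$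 are invertible, so that $\Lambda_h$ and $\Xi^{(k)}_h$ are well defined; almost surely, $v_h(n)\to\Lambda_h$ and $w^{(k)}_h(n)\to\Xi^{(k)}_h$ as $n\to\infty$ for all $h=0,\dots,H$ and $k=1,\dots,M$; and $\Lambda_h$ and $\Xi^{(k)}_h$ are Lipschitz continuous functions of $(\theta,\lambda)$ whenever $\theta$ and $\lambda$ range over compact sets. -/

import Mathlib

open Filter Topology MeasureTheory ProbabilityTheory
open scoped Matrix

namespace FiniteHorizon

noncomputable section

/-- A finite-horizon constrained Markov decision process with finite state space `S`, finite action
space `A`, horizon `H` and `M` constraints. -/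
structure CMDP (S A : Type*) [Fintype S] (H M : ℕ) where
  /-- transition probabilities `p_h(s, a, s')` -/
  p : Fin H → S → A → S → ℝ
  p_nonneg : ∀ h s a s', 0 ≤ p h s a s'
  p_sum : ∀ h s a, ∑ s', p h s a s' = 1
  /-- initial state distribution -/
  β : S → ℝ
  β_nonneg : ∀ s, 0 ≤ β s
  β_sum : ∑ s, β s = 1
  /-- single-stage rewards `r_h(s, a, s')` and terminal reward `r_H(s)` -/
  r : Fin H → S → A → S → ℝ
  rT : S → ℝ
  /-- single-stage constraint costs, terminal constraint costs and thresholds -/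
  g : Fin M → Fin H → S → A → S → ℝ
  gT : Fin M → S → ℝ
  α : Fin M → ℝ

/-- The parameter `θ = (θ_0, …, θ_{H-1})` with `θ_h ∈ ℝ^{y_h}`. -/
abbrev Param {H : ℕ} (y : Fin H → ℕ) : Type := ∀ h : Fin H, Fin (y h) → ℝ

/-- A parameterized class of non-stationary randomized policies `μ_{θ_h}(s, a)`: positive
distributions on the actions, twice continuously differentiable in the parameter. -/
structure PolicyClass (S A : Type*) [Fintype A] {H : ℕ} (y : Fin H → ℕ) where
  μ : ∀ h : Fin H, (Fin (y h) → ℝ) → S → A → ℝ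
  μ_pos : ∀ h t s a, 0 < μ h t s a
  μ_sum : ∀ h t s, ∑ a, μ h t s a = 1
  μ_contDiff : ∀ h s a, ContDiff ℝ 2 (fun t => μ h t s a)

/-- One episode: the visited states `s_0, …, s_H` and the actions `a_0, …, a_{H-1}`. -/
structure Episode (S A : Type*) (H : ℕ) where
  state : Fin (H + 1) → S
  action : Fin H → A

/-- Episodes carry the discrete σ-algebra (there are only finitely many of them). -/
instance {S A : Type*} {H : ℕ} : MeasurableSpace (Episode S A H) := ⊤

section Model

variable {S A : Type*} [Fintype S] [Fintype A] {H M : ℕ} {y : Fin H → ℕ}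

/-- The state distribution `d^θ_h(s)`: the probability that the state at instant `h` is `s`. -/
def stateDist (mdp : CMDP S A H M) (pol : PolicyClass S A y) (θ : Param y) :
    Fin (H + 1) → S → ℝ :=
  Fin.induction mdp.β
    (fun h d s' => ∑ s, d s * ∑ a, pol.μ h (θ h) s a * mdp.p h s a s')

/-- The set `S_h` of states that can be visited at instant `h` under `π_θ`. -/
abbrev Visited (mdp : CMDP S A H M) (pol : PolicyClass S A y) (θ : Param y) (h : Fin (H + 1)) :
    Type _ :=
  {s : S // 0 < stateDist mdp pol θ h s}

/-- The probability of an episode under `π_θ`: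
`β(s_0) ∏_h μ_{θ_h}(s_h, a_h) p_h(s_h, a_h, s_{h+1})`. -/
def episodeProb (mdp : CMDP S A H M) (pol : PolicyClass S A y) (θ : Param y)
    (e : Episode S A H) : ℝ :=
  mdp.β (e.state 0) *
    ∏ h : Fin H, pol.μ h (θ h) (e.state h.castSucc) (e.action h) *
      mdp.p h (e.state h.castSucc) (e.action h) (e.state h.succ)

/-- `ep n`, `n ≥ 0`, are independent episodes, each simulated under the fixed policy `π_θ`. -/
structure IsEpisodeSequence {Ω : Type*} [MeasurableSpace Ω] (P : Measure Ω)
    (mdp : CMDP S A H M) (pol : PolicyClass S A y) (θ : Param y)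
    (ep : ℕ → Ω → Episode S A H) : Prop where
  measurable : ∀ n, Measurable (ep n)
  indep : iIndepFun ep P
  law : ∀ n e, P (ep n ⁻¹' {e}) = ENNReal.ofReal (episodeProb mdp pol θ e)

/-- Single-stage cost of the Lagrangian, `c^λ_h = r_h + ∑_k λ^{(k)} g^{(k)}_h`. -/
def lagCost (mdp : CMDP S A H M) (lam : Fin M → ℝ) (h : Fin H) (s : S) (a : A) (s' : S) : ℝ :=
  mdp.r h s a s' + ∑ k, lam k * mdp.g k h s a s'

/-- Terminal cost of the Lagrangian, `c^λ_H = r_H + ∑_k λ^{(k)} (g^{(k)}_H - α^{(k)})`. -/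
def lagTerminal (mdp : CMDP S A H M) (lam : Fin M → ℝ) (s : S) : ℝ :=
  mdp.rT s + ∑ k, lam k * (mdp.gT k s - mdp.α k)

end Model

section Critic

variable {S A : Type*} {H : ℕ} {x : Fin (H + 1) → ℕ}

/-- One linear TD update of all the weights `v_0, …, v_H` along the episode `e`, for the
single-stage costs `c`, the terminal cost `cT`, the features `φ` and the step size `a`:
`v_h + a δ_h φ_h(s_h)` for `h < H`, with
`δ_h = c_h(s_h, a_h, s_{h+1}) + v_{h+1}ᵀ φ_{h+1}(s_{h+1}) - v_hᵀ φ_h(s_h)`,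
and `v_H + a (c_H(s_H) - v_Hᵀ φ_H(s_H)) φ_H(s_H)`. -/
def tdStep (φ : ∀ h, S → Fin (x h) → ℝ) (c : Fin H → S → A → S → ℝ) (cT : S → ℝ) (a : ℝ)
    (e : Episode S A H) (v : ∀ h, Fin (x h) → ℝ) : ∀ h, Fin (x h) → ℝ :=
  Fin.lastCases
    (v (Fin.last H) +
      (a * (cT (e.state (Fin.last H)) - v (Fin.last H) ⬝ᵥ φ (Fin.last H) (e.state (Fin.last H)))) •
        φ (Fin.last H) (e.state (Fin.last H)))
    (fun h => v h.castSucc +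
      (a * (c h (e.state h.castSucc) (e.action h) (e.state h.succ)
          + v h.succ ⬝ᵥ φ h.succ (e.state h.succ)
          - v h.castSucc ⬝ᵥ φ h.castSucc (e.state h.castSucc))) •
        φ h.castSucc (e.state h.castSucc))

/-- The TD critic iterates, started at `v₀`, with step sizes `a n` and episodes `e n`. -/
def tdCritic (φ : ∀ h, S → Fin (x h) → ℝ) (c : Fin H → S → A → S → ℝ) (cT : S → ℝ) (a : ℕ → ℝ)
    (e : ℕ → Episode S A H) (v₀ : ∀ h, Fin (x h) → ℝ) : ℕ → ∀ h, Fin (x h) → ℝ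
  | 0 => v₀
  | n + 1 => tdStep φ c cT (a n) (e n) (tdCritic φ c cT a e v₀ n)

variable [Fintype S] {M : ℕ}

/-- The main critic iterates `v_h(n)`, for the fixed multiplier `lam`. -/
def mainCritic (mdp : CMDP S A H M) (φ : ∀ h, S → Fin (x h) → ℝ) (lam : Fin M → ℝ) (a : ℕ → ℝ)
    (e : ℕ → Episode S A H) (v₀ : ∀ h, Fin (x h) → ℝ) : ℕ → ∀ h, Fin (x h) → ℝ :=
  tdCritic φ (lagCost mdp lam) (lagTerminal mdp lam) a e v₀

/-- The critic iterates `w^{(k)}_h(n)` of the `k`-th constraint. -/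
def constraintCritic (mdp : CMDP S A H M) (φ : ∀ h, S → Fin (x h) → ℝ) (k : Fin M) (a : ℕ → ℝ)
    (e : ℕ → Episode S A H) (w₀ : ∀ h, Fin (x h) → ℝ) : ℕ → ∀ h, Fin (x h) → ℝ :=
  tdCritic φ (mdp.g k) (fun s => mdp.gT k s - mdp.α k) a e w₀

end Critic

section Limit

variable {S A : Type*} [Fintype S] [DecidableEq S] [Fintype A] {H M : ℕ} {y : Fin H → ℕ}
  {x : Fin (H + 1) → ℕ}

/-- The feature matrix `Φ_h ∈ ℝ^{|S_h| × x_h}`. -/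
def featureMatrix (mdp : CMDP S A H M) (pol : PolicyClass S A y) (φ : ∀ h, S → Fin (x h) → ℝ)
    (θ : Param y) (h : Fin (H + 1)) : Matrix (Visited mdp pol θ h) (Fin (x h)) ℝ :=
  Matrix.of fun s k => φ h s k

/-- The diagonal matrix `D^θ_h` with entries `d^θ_h(s)`, `s ∈ S_h`. -/
def distMatrix (mdp : CMDP S A H M) (pol : PolicyClass S A y)
    (θ : Param y) (h : Fin (H + 1)) : Matrix (Visited mdp pol θ h) (Visited mdp pol θ h) ℝ :=
  Matrix.diagonal fun s => stateDist mdp pol θ h s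

/-- The transition matrix `P^θ_h(s, s') = ∑_a μ_{θ_h}(s, a) p_h(s, a, s')`. -/
def transMatrix (mdp : CMDP S A H M) (pol : PolicyClass S A y) (θ : Param y) (h : Fin H) :
    Matrix (Visited mdp pol θ h.castSucc) (Visited mdp pol θ h.succ) ℝ :=
  Matrix.of fun s s' => ∑ a, pol.μ h (θ h) s a * mdp.p h s a s'

/-- The vector `∑_a μ_{θ_h}(s, a) ∑_{s'} p_h(s, a, s') c_h(s, a, s')`, `s ∈ S_h`, of expected
single-stage costs. -/
def meanCost (mdp : CMDP S A H M) (pol : PolicyClass S A y) (c : Fin H → S → A → S → ℝ)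
    (θ : Param y) (h : Fin H) : Visited mdp pol θ h.castSucc → ℝ :=
  fun s => ∑ a, pol.μ h (θ h) s a * ∑ s' : S, mdp.p h s a s' * c h s a s'

/-- The matrix `Φ_hᵀ D^θ_h Φ_h`. -/
def gram (mdp : CMDP S A H M) (pol : PolicyClass S A y) (φ : ∀ h, S → Fin (x h) → ℝ)
    (θ : Param y) (h : Fin (H + 1)) : Matrix (Fin (x h)) (Fin (x h)) ℝ :=
  (featureMatrix mdp pol φ θ h)ᵀ * distMatrix mdp pol θ h * featureMatrix mdp pol φ θ h

/-- Backward recursion of weighted projected Bellman equations with single-stage costs `c` and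
terminal cost `cT`:
`u_H = (Φ_Hᵀ D_H Φ_H)⁻¹ Φ_Hᵀ D_H C_H` and
`u_h = (Φ_hᵀ D_h Φ_h)⁻¹ (Φ_hᵀ D_h P_h Φ_{h+1} u_{h+1} + Φ_hᵀ D_h C_h)` for `h < H`. -/
def projectedBellman (mdp : CMDP S A H M) (pol : PolicyClass S A y) (φ : ∀ h, S → Fin (x h) → ℝ)
    (c : Fin H → S → A → S → ℝ) (cT : S → ℝ) (θ : Param y) :
    ∀ h : Fin (H + 1), Fin (x h) → ℝ :=
  Fin.reverseInduction
    ((gram mdp pol φ θ (Fin.last H))⁻¹ *ᵥ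
      (((featureMatrix mdp pol φ θ (Fin.last H))ᵀ * distMatrix mdp pol θ (Fin.last H)) *ᵥ
        fun s => cT s))
    (fun h u =>
      (gram mdp pol φ θ h.castSucc)⁻¹ *ᵥ
        (((featureMatrix mdp pol φ θ h.castSucc)ᵀ * distMatrix mdp pol θ h.castSucc *
            transMatrix mdp pol θ h * featureMatrix mdp pol φ θ h.succ) *ᵥ u
          + ((featureMatrix mdp pol φ θ h.castSucc)ᵀ * distMatrix mdp pol θ h.castSucc) *ᵥ
              meanCost mdp pol c θ h))

/-- The points `Λ_h`. -/
def mainLimit (mdp : CMDP S A H M) (pol : PolicyClass S A y) (φ : ∀ h, S → Fin (x h) → ℝ)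
    (θ : Param y) (lam : Fin M → ℝ) : ∀ h : Fin (H + 1), Fin (x h) → ℝ :=
  projectedBellman mdp pol φ (lagCost mdp lam) (lagTerminal mdp lam) θ

/-- The points `Ξ^{(k)}_h`. -/
def constraintLimit (mdp : CMDP S A H M) (pol : PolicyClass S A y)
    (φ : ∀ h, S → Fin (x h) → ℝ) (k : Fin M) (θ : Param y) :
    ∀ h : Fin (H + 1), Fin (x h) → ℝ :=
  projectedBellman mdp pol φ (mdp.g k) (fun s => mdp.gT k s - mdp.α k) θ

end Limit

end

end FiniteHorizon

/-! Randomness enters only through finitely many real series. There are finitely many episodes `e`,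
and for each one the centred weighted counts `a i * (1{ep i = e} - q e)` are independent with
summable variances, so their series converges almost surely (`ae_exists_tendsto_sum_indicator`).
Since any observable of an episode is a finite combination of these indicators, the weighted
fluctuations of the update matrices and of the noise converge too
(`exists_tendsto_sum_smul_sub_mean`). From there on the argument is deterministic along one
trajectory.

Each `v_h` follows a least-mean-squares recursion whose mean matrix is the Gram matrix, positive
definite by linear independence of the features on visited states. Subtracting the tails of the
convergent series from the error turns the recursion into a perturbed contraction
(`tendsto_zero_of_linear_recursion`); linearity makes a prior bound on the iterates unnecessary.
Backward induction on `h` closes the argument: stage `h` sees the error of stage `h + 1` only as a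
vanishing perturbation, and the mean increment vanishes at the projected Bellman point
(`tendsto_tdCritic`).

For the Lipschitz claim, the state distributions are polynomials in policy probabilities and the
inverse Gram matrix is given by Cramer's rule, so the limits are C¹ (`contDiff_projectedBellman`).
-/

namespace FiniteHorizon

/-! ### Almost sure convergence of random series -/

/-- A series of independent centred square-integrable variables with summable second moments
converges almost surely. -/
theorem ae_exists_tendsto_sum_of_iIndepFun {Ω : Type*} [MeasurableSpace Ω] {P : Measure Ω}
    [IsProbabilityMeasure P] {Y : ℕ → Ω → ℝ} (hm : ∀ n, StronglyMeasurable (Y n))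
    (hi : iIndepFun Y P) (h2 : ∀ n, MemLp (Y n) 2 P) (h0 : ∀ n, ∫ ω, Y n ω ∂P = 0)
    (hs : Summable fun n => ∫ ω, Y n ω ^ 2 ∂P) :
    ∀ᵐ ω ∂P, ∃ l, Tendsto (fun n => ∑ i ∈ Finset.range n, Y i ω) atTop (𝓝 l) := by
  have hint : ∀ n, Integrable (Y n) P := fun n => (h2 n).integrable one_le_two
  -- The sum runs through index `n`, so that `f n` is adapted to the natural filtration; the shift
  -- is undone at the end.
  set f : ℕ → Ω → ℝ := fun n => ∑ i ∈ Finset.range (n + 1), Y i with hf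
  set ℱ := Filtration.natural Y hm
  have hfint : ∀ n, Integrable (f n) P := fun n => integrable_finsetSum' _ fun i _ => hint i
  have hf2 : ∀ n, MemLp (f n) 2 P := fun n => memLp_finsetSum' _ fun i _ => h2 i
  have hf0 : ∀ n, ∫ ω, f n ω ∂P = 0 := fun n => by
    simp [hf, Finset.sum_apply, integral_finsetSum _ fun i _ => hint i, h0]
  have hsub : Submartingale f ℱ P := by
    refine submartingale_of_condExp_sub_nonneg_nat (fun n => ?_) hfint fun n => ?_
    · exact Finset.stronglyMeasurable_sum _ fun i hi =>
        (Filtration.stronglyAdapted_natural hm).stronglyMeasurable_le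
          (Nat.lt_succ_iff.1 (Finset.mem_range.1 hi))
    · have e : f (n + 1) - f n = Y (n + 1) := by
        simp [hf, Finset.sum_range_succ _ (n + 1)]
      rw [e]
      filter_upwards [hi.condExp_natural_ae_eq_of_lt hm (Nat.lt_succ_self n)] with ω hω
      rw [hω, h0]; rfl
  have hvar : ∀ n, ∫ ω, f n ω ^ 2 ∂P ≤ ∑' n, ∫ ω, Y n ω ^ 2 ∂P := fun n => by
    have h := IndepFun.variance_sum (X := Y) (s := Finset.range (n + 1)) (fun i _ => h2 i)
      (fun i _ j _ hij => hi.indepFun hij)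
    rw [variance_of_integral_eq_zero (hf2 n).aemeasurable (hf0 n)] at h
    rw [h, Finset.sum_congr rfl fun i _ =>
      variance_of_integral_eq_zero (hint i).aemeasurable (h0 i)]
    exact hs.sum_le_tsum _ fun i _ => integral_nonneg fun ω => sq_nonneg _
  -- The L² bound gives the L¹ bound required for martingale convergence, through `|t| ≤ 1 + t²`.
  have hbdd : ∀ n, eLpNorm (f n) 1 P ≤ (Real.toNNReal (1 + ∑' n, ∫ ω, Y n ω ^ 2 ∂P)) := fun n => by
    rw [eLpNorm_one_eq_lintegral_enorm, ← ofReal_integral_norm_eq_lintegral_enorm (hfint n)]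
    refine ENNReal.ofReal_le_ofReal ?_
    calc ∫ ω, ‖f n ω‖ ∂P ≤ ∫ ω, (1 + f n ω ^ 2) ∂P := by
          refine integral_mono (hfint n).norm
            ((integrable_const _).add (hf2 n).integrable_sq) fun ω => ?_
          rw [Real.norm_eq_abs]
          nlinarith [sq_nonneg (|f n ω| - 1), sq_abs (f n ω), abs_nonneg (f n ω)]
      _ = 1 + ∫ ω, f n ω ^ 2 ∂P := by
          rw [integral_add (integrable_const _) (hf2 n).integrable_sq]; simp
      _ ≤ _ := by gcongr; exact hvar n
  filter_upwards [hsub.exists_ae_tendsto_of_bdd hbdd] with ω ⟨l, hl⟩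
  refine ⟨l, (tendsto_add_atTop_iff_nat 1).1 ?_⟩
  simpa [hf, Finset.sum_apply] using hl

/-- Weighted empirical fluctuations of an independent identically distributed sequence in a
discrete space converge, with square-summable weights. -/
theorem ae_exists_tendsto_sum_indicator {Ω E : Type*} [MeasurableSpace Ω] {P : Measure Ω}
    [IsProbabilityMeasure P] [MeasurableSpace E] [MeasurableSingletonClass E]
    {X : ℕ → Ω → E} (hm : ∀ n, Measurable (X n))
    (hi : iIndepFun X P) {e : E} {q : ℝ} (hq : 0 ≤ q)
    (hlaw : ∀ n, P (X n ⁻¹' {e}) = ENNReal.ofReal q) {a : ℕ → ℝ}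
    (ha : Summable fun n => a n ^ 2) :
    ∀ᵐ ω ∂P, ∃ l, Tendsto
      (fun n => ∑ i ∈ Finset.range n, a i * (Set.indicator {e} 1 (X i ω) - q)) atTop (𝓝 l) := by
  have hq1 : q ≤ 1 := by
    have := hlaw 0 ▸ prob_le_one (μ := P) (s := X 0 ⁻¹' {e})
    simpa using this
  have hind : ∀ n ω, (Set.indicator {e} 1 (X n ω) : ℝ) ∈ Set.Icc (0 : ℝ) 1 := fun n ω => by
    by_cases h : X n ω = e <;> simp [Set.indicator, h]
  have hmeas : ∀ n, Measurable fun x : E => a n * (Set.indicator {e} (1 : E → ℝ) x - q) := fun n =>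
    ((measurable_one.indicator (measurableSet_singleton e)).sub_const q).const_mul _
  have hY : ∀ n, Measurable fun ω => a n * (Set.indicator {e} (1 : E → ℝ) (X n ω) - q) :=
    fun n => (hmeas n).comp (hm n)
  have hb : ∀ n ω, ‖a n * (Set.indicator {e} (1 : E → ℝ) (X n ω) - q)‖ ≤ |a n| := fun n ω => by
    rw [norm_mul, Real.norm_eq_abs, Real.norm_eq_abs]
    refine mul_le_of_le_one_right (abs_nonneg _) (abs_le.2 ⟨?_, ?_⟩) <;>
      linarith [(hind n ω).1, (hind n ω).2]
  have hL2 : ∀ n, MemLp (fun ω => a n * (Set.indicator {e} (1 : E → ℝ) (X n ω) - q)) 2 P :=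
    fun n => MemLp.of_bound (hY n).aestronglyMeasurable _ (ae_of_all _ (hb n))
  refine ae_exists_tendsto_sum_of_iIndepFun (fun n => (hY n).stronglyMeasurable)
    (hi.comp _ hmeas) hL2 (fun n => ?_) ?_
  · have h1 : (fun ω => (Set.indicator {e} (1 : E → ℝ) (X n ω))) =
        Set.indicator (X n ⁻¹' {e}) 1 := rfl
    have h2 : ∫ ω, Set.indicator {e} (1 : E → ℝ) (X n ω) ∂P = q := by
      rw [h1, integral_indicator_one (hm n (measurableSet_singleton e)), Measure.real, hlaw,
        ENNReal.toReal_ofReal hq]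
    rw [integral_const_mul, integral_sub, h2]
    · simp
    · rw [h1]
      exact (integrable_const _).indicator (hm n (measurableSet_singleton e))
    · exact integrable_const _
  · refine Summable.of_nonneg_of_le (fun n => integral_nonneg fun ω => sq_nonneg _) (fun n => ?_) ha
    calc _ ≤ ∫ ω, a n ^ 2 ∂P := by
          refine integral_mono (hL2 n).integrable_sq (integrable_const _) fun ω => ?_
          exact sq_le_sq.2 (hb n ω)
      _ = a n ^ 2 := by simp

/-! ### Deterministic recursions with vanishing step sizes -/

/-- Once `δ n ≤ c * (ε / 2)`, the excess of `u` over `ε / 2` shrinks at each step by `1 - c * a n ≤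
exp (-(c * a n))`, and divergence of the step sizes drives the product of these factors to zero.
That `a` tends to zero makes the factors eventually nonnegative. -/
theorem tendsto_zero_of_le_one_sub_mul_add {u a δ : ℕ → ℝ} {c : ℝ} (hc : 0 < c)
    (hu : ∀ n, 0 ≤ u n) (ha : ∀ n, 0 < a n) (ha0 : Tendsto a atTop (𝓝 0))
    (has : Tendsto (fun n => ∑ i ∈ Finset.range n, a i) atTop atTop)
    (hδ : Tendsto δ atTop (𝓝 0))
    (h : ∀ᶠ n in atTop, u (n + 1) ≤ (1 - c * a n) * u n + a n * δ n) :
    Tendsto u atTop (𝓝 0) := by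
  refine Metric.tendsto_atTop'.2 fun ε hε => ?_
  have h1 : ∀ᶠ n in atTop, δ n ≤ c * (ε / 2) := hδ.eventually_le_const (by positivity)
  have h2 : ∀ᶠ n in atTop, a n ≤ 1 / c := ha0.eventually_le_const (by positivity)
  obtain ⟨N, hN⟩ := eventually_atTop.1 (h.and (h1.and h2))
  set w : ℕ → ℝ := fun n => max (u n - ε / 2) 0 with hw
  have hw0 : ∀ n, 0 ≤ w n := fun n => le_max_right _ _
  have hstep : ∀ n, N ≤ n → w (n + 1) ≤ Real.exp (-(c * a n)) * w n := by
    intro n hn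
    obtain ⟨hr, hd, hac⟩ := hN n hn
    have hca : c * a n ≤ 1 := by rwa [le_div_iff₀ hc, mul_comm] at hac
    have h3 : (1 - c * a n) * w n ≤ Real.exp (-(c * a n)) * w n :=
      mul_le_mul_of_nonneg_right (by linarith [Real.add_one_le_exp (-(c * a n))]) (hw0 n)
    refine le_trans ?_ h3
    refine max_le ?_ (mul_nonneg (by linarith) (hw0 n))
    have h4 : (1 - c * a n) * (u n - ε / 2) ≤ (1 - c * a n) * w n :=
      mul_le_mul_of_nonneg_left (le_max_left _ _) (by linarith)
    have h5 : a n * δ n ≤ a n * (c * (ε / 2)) := mul_le_mul_of_nonneg_left hd (ha n).le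
    nlinarith
  have hanti : ∀ n, N ≤ n → w n ≤
      Real.exp (-(c * ∑ i ∈ Finset.range n, a i)) *
        (Real.exp (c * ∑ i ∈ Finset.range N, a i) * w N) := by
    intro n hn
    induction n, hn using Nat.le_induction with
    | base => rw [← mul_assoc, ← Real.exp_add]; simp
    | succ n hn ih =>
      refine (hstep n hn).trans ?_
      rw [Finset.sum_range_succ, mul_add, neg_add, add_comm (-(c * _)), Real.exp_add, mul_assoc]
      exact mul_le_mul_of_nonneg_left ih (Real.exp_pos _).le
  have hlim : Tendsto (fun n => Real.exp (-(c * ∑ i ∈ Finset.range n, a i)) *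
        (Real.exp (c * ∑ i ∈ Finset.range N, a i) * w N)) atTop (𝓝 0) := by
    have := (Real.tendsto_exp_neg_atTop_nhds_zero.comp (has.const_mul_atTop hc)).mul_const
      (Real.exp (c * ∑ i ∈ Finset.range N, a i) * w N)
    simpa using this
  obtain ⟨N', hN'⟩ := eventually_atTop.1 (hlim.eventually_lt_const (half_pos hε))
  refine ⟨max N N', fun n hn => ?_⟩
  have h6 := (hanti n ((le_max_left _ _).trans hn.le)).trans_lt
    (hN' n ((le_max_right _ _).trans hn.le))
  have h7 : u n - ε / 2 ≤ w n := le_max_left _ _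
  rw [Real.dist_eq, sub_zero, abs_of_nonneg (hu n)]
  linarith

section LinearRecursion

variable {E : Type*} [NormedAddCommGroup E] [InnerProductSpace ℝ E]

/-- Expanding the square, the cross term contributes at most `-2 * t * κ * ‖z‖ ^ 2` and the
quadratic one at most `t * κ * ‖z‖ ^ 2`; then `1 - κ * t ≤ (1 - κ / 2 * t) ^ 2`. -/
theorem norm_sub_smul_le_of_coercive {B : E →L[ℝ] E} {κ t : ℝ}
    (hκ : ∀ z, κ * ‖z‖ ^ 2 ≤ inner ℝ (B z) z) (ht : 0 ≤ t) (htB : t * ‖B‖ ^ 2 ≤ κ)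
    (htκ : t * κ ≤ 2) (z : E) :
    ‖z - t • B z‖ ≤ (1 - κ / 2 * t) * ‖z‖ := by
  refine abs_le_of_sq_le_sq' ?_ (mul_nonneg (by linarith) (norm_nonneg _)) |>.2
  have h1 : ‖B z‖ ^ 2 ≤ ‖B‖ ^ 2 * ‖z‖ ^ 2 := by
    rw [← mul_pow]; exact pow_le_pow_left₀ (norm_nonneg _) (B.le_opNorm z) 2
  have h2 : t ^ 2 * ‖B z‖ ^ 2 ≤ t * κ * ‖z‖ ^ 2 :=
    calc t ^ 2 * ‖B z‖ ^ 2 ≤ t ^ 2 * (‖B‖ ^ 2 * ‖z‖ ^ 2) := by gcongr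
      _ = t * (t * ‖B‖ ^ 2) * ‖z‖ ^ 2 := by ring
      _ ≤ _ := by gcongr
  rw [norm_sub_sq_real, real_inner_smul_right, norm_smul, Real.norm_eq_abs, mul_pow, sq_abs,
    real_inner_comm]
  have h3 := mul_le_mul_of_nonneg_left (hκ z) ht
  nlinarith [mul_nonneg (sq_nonneg (κ / 2 * t)) (sq_nonneg ‖z‖)]

/-- Convergence to zero of a linear stochastic approximation recursion along a fixed trajectory:
it suffices that the weighted fluctuations of the matrices and of the noise are summable. -/
theorem tendsto_zero_of_linear_recursion {a : ℕ → ℝ} (ha : ∀ n, 0 < a n)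
    (ha0 : Tendsto a atTop (𝓝 0))
    (has : Tendsto (fun n => ∑ i ∈ Finset.range n, a i) atTop atTop)
    {B : E →L[ℝ] E} {κ : ℝ} (hκ0 : 0 < κ) (hκ : ∀ z, κ * ‖z‖ ^ 2 ≤ inner ℝ (B z) z)
    {Bn : ℕ → E →L[ℝ] E} {ξ b e : ℕ → E} {C : ℝ} (hBn : ∀ n, ‖Bn n‖ ≤ C) (hξ : ∀ n, ‖ξ n‖ ≤ C)
    (hb : Tendsto b atTop (𝓝 0))
    {R : E →L[ℝ] E} {r : E}
    (hR : Tendsto (fun n => ∑ i ∈ Finset.range n, a i • (Bn i - B)) atTop (𝓝 R))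
    (hr : Tendsto (fun n => ∑ i ∈ Finset.range n, a i • ξ i) atTop (𝓝 r))
    (he : ∀ n, e (n + 1) = e n + a n • (-(Bn n (e n)) + ξ n + b n)) :
    Tendsto e atTop (𝓝 0) := by
  -- `Rn` and `rn` are tails of the convergent series. In `f = e - Rn e + rn` their increments
  -- cancel the fluctuations exactly, leaving the mean drift `-B e`, the term `b`, and `Rn (n + 1)`
  -- applied to one increment of `e`, which has order `a n`.
  set Rn : ℕ → E →L[ℝ] E := fun n => R - ∑ i ∈ Finset.range n, a i • (Bn i - B) with hRn
  set rn : ℕ → E := fun n => r - ∑ i ∈ Finset.range n, a i • ξ i with hrn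
  have hRn0 : Tendsto Rn atTop (𝓝 0) := by simpa using hR.const_sub R
  have hrn0 : Tendsto rn atTop (𝓝 0) := by simpa using hr.const_sub r
  have hRs : ∀ n, Rn n = Rn (n + 1) + a n • (Bn n - B) := fun n => by
    simp only [hRn, Finset.sum_range_succ]; abel
  have hrs : ∀ n, rn n = rn (n + 1) + a n • ξ n := fun n => by
    simp only [hrn, Finset.sum_range_succ]; abel
  have hC : 0 ≤ C := (norm_nonneg _).trans (hξ 0)
  set f : ℕ → E := fun n => e n - Rn n (e n) + rn n with hf
  set ε : ℕ → ℝ := fun n => ‖Rn n‖ + ‖rn n‖ with hε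
  have hε0 : Tendsto ε atTop (𝓝 0) := by simpa using hRn0.norm.add hrn0.norm
  have hεn : ∀ n, 0 ≤ ε n := fun n => by positivity
  have hfe : ∀ n, ‖e n - f n‖ ≤ ε n * (‖e n‖ + 1) := fun n => by
    have h1 : e n - f n = Rn n (e n) - rn n := by simp only [hf]; abel
    rw [h1]
    have := (Rn n).le_opNorm (e n)
    have := norm_sub_le (Rn n (e n)) (rn n)
    simp only [hε]
    nlinarith [norm_nonneg (Rn n), norm_nonneg (rn n), norm_nonneg (e n),
      mul_nonneg (norm_nonneg (rn n)) (norm_nonneg (e n))]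
  have hstep : ∀ n, f (n + 1) = (f n - a n • B (f n)) +
      (a n • (B (f n - e n) + b n) + Rn (n + 1) (e n - e (n + 1))) := fun n => by
    have h1 : f n = e n - (Rn (n + 1) (e n) + a n • (Bn n (e n) - B (e n))) +
        (rn (n + 1) + a n • ξ n) := by
      rw [← hrs n]
      simp only [hf]
      conv_lhs => rw [hRs n]
      simp
    have h2 : f (n + 1) = e (n + 1) - Rn (n + 1) (e (n + 1)) + rn (n + 1) := rfl
    have h3 : f (n + 1) = f n - a n • B (e n) + a n • b n + Rn (n + 1) (e n - e (n + 1)) := by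
      rw [h1, h2, map_sub]
      nth_rewrite 1 [he n]
      module
    rw [h3, map_sub B]
    module
  set η : ℕ → ℝ := fun n => 2 * ‖B‖ * ε n + ‖b n‖ + ε (n + 1) * (2 * C + ‖b n‖) with hη
  have hη0 : Tendsto η atTop (𝓝 0) := by
    have h1 := hε0.const_mul (2 * ‖B‖)
    have h2 := (tendsto_add_atTop_iff_nat 1).2 hε0
    have h3 := hb.norm
    have h4 := (h1.add h3).add (h2.mul (h3.const_add (2 * C)))
    simpa using h4
  have hsmall : ∀ᶠ n in atTop, ε n ≤ 1 / 2 := hε0.eventually_le_const (by norm_num)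
  -- With `ε n ≤ 1 / 2` the term `ε n * ‖e n‖` is absorbed on the left, so the size of `e` is
  -- controlled by that of `f`.
  have hfe2 : ∀ᶠ n in atTop, ‖e n‖ ≤ 2 * ‖f n‖ + 1 := by
    filter_upwards [hsmall] with n hn
    have h1 := hfe n
    have h2 := norm_le_norm_add_norm_sub' (e n) (f n)
    nlinarith [mul_le_mul_of_nonneg_right hn (by positivity : 0 ≤ ‖e n‖ + 1)]
  have hf0 : Tendsto (fun n => ‖f n‖) atTop (𝓝 0) := by
    refine tendsto_zero_of_le_one_sub_mul_add (c := κ / 4) (δ := η) (by positivity)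
      (fun n => norm_nonneg _) ha ha0 has hη0 ?_
    have e1 : ∀ᶠ n in atTop, a n * ‖B‖ ^ 2 ≤ κ := by
      have := ha0.mul_const (‖B‖ ^ 2)
      rw [zero_mul] at this
      exact this.eventually_le_const hκ0
    have e2 : ∀ᶠ n in atTop, a n * κ ≤ 2 := by
      have := ha0.mul_const κ
      rw [zero_mul] at this
      exact this.eventually_le_const two_pos
    -- Half of the contraction rate `κ / 2` pays for the error proportional to `‖f n‖`; the rate `κ
    -- / 4` remains.
    have e3 : ∀ᶠ n in atTop, η n ≤ κ / 4 := hη0.eventually_le_const (by positivity)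
    filter_upwards [e1, e2, e3, hfe2] with n h1 h2 h3 h4
    have h5 := norm_sub_smul_le_of_coercive hκ (ha n).le h1 h2 (f n)
    have h6 : ‖B (f n - e n)‖ ≤ ‖B‖ * (ε n * (‖e n‖ + 1)) :=
      (B.le_opNorm _).trans (by rw [norm_sub_rev]; gcongr; exact hfe n)
    have h7 : ‖e n - e (n + 1)‖ ≤ a n * (C * ‖e n‖ + C + ‖b n‖) := by
      rw [he n, sub_add_cancel_left, norm_neg, norm_smul, Real.norm_eq_abs, abs_of_pos (ha n)]
      gcongr
      · exact (ha n).le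
      · refine (norm_add₃_le).trans ?_
        rw [norm_neg]
        have := (Bn n).le_opNorm (e n)
        have := mul_le_mul_of_nonneg_right (hBn n) (norm_nonneg (e n))
        linarith [hξ n]
    have h8 : ‖Rn (n + 1) (e n - e (n + 1))‖ ≤ ε (n + 1) * (a n * (C * ‖e n‖ + C + ‖b n‖)) :=
      ((Rn (n + 1)).le_opNorm _).trans
        (mul_le_mul (le_add_of_nonneg_right (norm_nonneg _)) h7 (norm_nonneg _) (hεn _))
    have h9 : ‖f (n + 1)‖ ≤ ‖f n - a n • B (f n)‖ + (a n * (‖B (f n - e n)‖ + ‖b n‖) +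
        ‖Rn (n + 1) (e n - e (n + 1))‖) := by
      rw [hstep n]
      refine (norm_add_le _ _).trans ?_
      gcongr
      refine (norm_add_le _ _).trans ?_
      gcongr
      rw [norm_smul, Real.norm_eq_abs, abs_of_pos (ha n)]
      exact mul_le_mul_of_nonneg_left (norm_add_le _ _) (ha n).le
    have h10 : ‖B (f n - e n)‖ + ‖b n‖ + ε (n + 1) * (C * ‖e n‖ + C + ‖b n‖) ≤
        η n * (‖f n‖ + 1) := by
      have i1 : ‖B‖ * (ε n * (‖e n‖ + 1)) ≤ ‖B‖ * (ε n * (2 * ‖f n‖ + 1 + 1)) := by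
        have := hεn n
        gcongr
      have i2 : ε (n + 1) * (C * ‖e n‖ + C + ‖b n‖) ≤
          ε (n + 1) * (C * (2 * ‖f n‖ + 1) + C + ‖b n‖) := by
        have := hεn (n + 1)
        gcongr
      have i3 := mul_nonneg (norm_nonneg (b n)) (norm_nonneg (f n))
      have i4 := mul_nonneg (hεn (n + 1)) i3
      simp only [hη]
      nlinarith
    have h11 : a n * (η n * (‖f n‖ + 1)) ≤ a n * (κ / 4 * ‖f n‖ + η n) := by
      refine mul_le_mul_of_nonneg_left ?_ (ha n).le
      nlinarith [mul_le_mul_of_nonneg_right h3 (norm_nonneg (f n))]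
    have h12 := mul_le_mul_of_nonneg_left h10 (ha n).le
    nlinarith
  have hlim : Tendsto (fun n => ‖f n‖ + ε n * (2 * ‖f n‖ + 1 + 1)) atTop (𝓝 0) := by
    have := hf0.add (hε0.mul (((hf0.const_mul 2).add_const 1).add_const 1))
    simpa using this
  refine squeeze_zero_norm' ?_ hlim
  filter_upwards [hfe2] with n hn
  have h1 := hfe n
  have h2 := norm_le_norm_add_norm_sub' (e n) (f n)
  have := hεn n
  have h3 : ε n * (‖e n‖ + 1) ≤ ε n * (2 * ‖f n‖ + 1 + 1) := by gcongr
  linarith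

end LinearRecursion

/-! ### Marginals of an inhomogeneous controlled chain -/

section PathSums

variable {S A : Type*}

/-- Weight of a trajectory of an inhomogeneous controlled chain with initial weights `β` and
kernels `K`. -/
noncomputable def pathWeight {H : ℕ} (β : S → ℝ) (K : Fin H → S → A → S → ℝ)
    (st : Fin (H + 1) → S) (ac : Fin H → A) : ℝ :=
  β (st 0) * ∏ h : Fin H, K h (st h.castSucc) (ac h) (st h.succ)

theorem pathWeight_snoc {H : ℕ} (β : S → ℝ) (K : Fin (H + 1) → S → A → S → ℝ)
    (st : Fin (H + 1) → S) (ac : Fin H → A) (s : S) (a : A) :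
    pathWeight β K (Fin.snoc st s : Fin (H + 2) → S) (Fin.snoc ac a : Fin (H + 1) → A) =
      pathWeight β (fun i => K i.castSucc) st ac * K (Fin.last H) (st (Fin.last H)) a s := by
  have h0 : (Fin.snoc st s : Fin (H + 2) → S) 0 = st 0 := by
    rw [← Fin.castSucc_zero, Fin.snoc_castSucc (α := fun _ => S)]
  simp only [pathWeight, Fin.prod_univ_castSucc, h0, Fin.succ_castSucc,
    Fin.snoc_castSucc (α := fun _ => S), Fin.snoc_castSucc (α := fun _ => A), Fin.succ_last,
    Fin.snoc_last, mul_assoc]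

variable [Fintype S] [Fintype A]

/-- Marginal state weights of an inhomogeneous controlled chain. -/
noncomputable def pathDist {H : ℕ} (β : S → ℝ) (K : Fin H → S → A → S → ℝ) :
    Fin (H + 1) → S → ℝ :=
  Fin.induction β fun h d s' => ∑ s, d s * ∑ a, K h s a s'

theorem pathDist_zero {H : ℕ} (β : S → ℝ) (K : Fin H → S → A → S → ℝ) :
    pathDist β K 0 = β := rfl

theorem pathDist_succ {H : ℕ} (β : S → ℝ) (K : Fin H → S → A → S → ℝ) (h : Fin H) (s' : S) :
    pathDist β K h.succ s' = ∑ s, pathDist β K h.castSucc s * ∑ a, K h s a s' := rfl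

theorem pathDist_castSucc {H : ℕ} (β : S → ℝ) (K : Fin (H + 1) → S → A → S → ℝ)
    (h : Fin (H + 1)) :
    pathDist β K h.castSucc = pathDist β (fun i => K i.castSucc) h := by
  induction h using Fin.induction with
  | zero => rfl
  | succ i ih =>
    ext s'
    rw [pathDist_succ, ← Fin.succ_castSucc, pathDist_succ, ih]

theorem sum_path_snoc {H : ℕ} (F : (Fin (H + 2) → S) → (Fin (H + 1) → A) → ℝ) :
    ∑ st, ∑ ac, F st ac = ∑ st : Fin (H + 1) → S, ∑ ac : Fin H → A, ∑ a, ∑ s,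
      F (Fin.snoc st s : Fin (H + 2) → S) (Fin.snoc ac a : Fin (H + 1) → A) := by
  rw [← (Fin.snocEquiv fun _ : Fin (H + 2) => S).sum_comp, Fintype.sum_prod_type_right]
  refine Finset.sum_congr rfl fun st _ => ?_
  rw [Finset.sum_comm, ← (Fin.snocEquiv fun _ : Fin (H + 1) => A).sum_comp,
    Fintype.sum_prod_type_right]
  rfl

/-- Induction on the horizon, splitting off the last transition. If `h` is the final time, that
transition is averaged into the test function; otherwise it sums to one and disappears. -/
theorem sum_pathWeight_mul_state {H : ℕ} (β : S → ℝ) (K : Fin H → S → A → S → ℝ)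
    (hK : ∀ h s, ∑ a, ∑ s', K h s a s' = 1) (h : Fin (H + 1)) (f : S → ℝ) :
    ∑ st, ∑ ac, pathWeight β K st ac * f (st h) = ∑ s, pathDist β K h s * f s := by
  induction H generalizing f with
  | zero =>
    obtain rfl : h = 0 := Subsingleton.elim (α := Fin 1) _ _
    rw [← (Equiv.funUnique (Fin 1) S).symm.sum_comp]
    simp [pathWeight, pathDist_zero]
  | succ H ih =>
    rw [sum_path_snoc]
    simp only [pathWeight_snoc]
    induction h using Fin.lastCases with
    | last =>
      have h1 := ih (fun i => K i.castSucc) (fun i s => hK _ s) (Fin.last H)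
        fun s => ∑ a, ∑ s', K (Fin.last H) s a s' * f s'
      rw [← Fin.succ_last]
      simp only [pathDist_succ, pathDist_castSucc, Finset.sum_mul]
      conv_rhs => rw [Finset.sum_comm]
      simp only [mul_assoc, ← Finset.mul_sum]
      refine Eq.trans ?_ (h1.trans (Finset.sum_congr rfl fun s _ => ?_))
      · simp only [Fin.succ_last, Fin.snoc_last]
      · congr 1
        rw [Finset.sum_comm]
        simp only [Finset.sum_mul]
    | cast j =>
      rw [pathDist_castSucc, ← ih (fun i => K i.castSucc) (fun i s => hK _ s) j f]
      refine Finset.sum_congr rfl fun st _ => Finset.sum_congr rfl fun ac _ => ?_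
      simp only [Fin.snoc_castSucc (α := fun _ => S), mul_assoc, ← Finset.mul_sum,
        ← Finset.sum_mul, hK, one_mul]

theorem sum_pathWeight_mul_step {H : ℕ} (β : S → ℝ) (K : Fin H → S → A → S → ℝ)
    (hK : ∀ h s, ∑ a, ∑ s', K h s a s' = 1) (h : Fin H) (f : S → A → S → ℝ) :
    ∑ st, ∑ ac, pathWeight β K st ac * f (st h.castSucc) (ac h) (st h.succ) =
      ∑ s, pathDist β K h.castSucc s * ∑ a, ∑ s', K h s a s' * f s a s' := by
  induction H with
  | zero => exact h.elim0
  | succ H ih =>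
    rw [sum_path_snoc]
    simp only [pathWeight_snoc]
    induction h using Fin.lastCases with
    | last =>
      rw [pathDist_castSucc, ← sum_pathWeight_mul_state _ _ (fun i s => hK _ s)]
      simp only [Fin.succ_last, Fin.snoc_last, Fin.snoc_castSucc (α := fun _ => S), mul_assoc,
        ← Finset.mul_sum]
    | cast j =>
      rw [pathDist_castSucc, ← ih (fun i => K i.castSucc) (fun i s => hK _ s) j]
      refine Finset.sum_congr rfl fun st _ => Finset.sum_congr rfl fun ac _ => ?_
      simp only [Fin.snoc_castSucc (α := fun _ => S), Fin.snoc_castSucc (α := fun _ => A),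
        Fin.succ_castSucc, mul_assoc, ← Finset.mul_sum, ← Finset.sum_mul, hK, one_mul]

end PathSums

/-! ### Expectations over episodes -/

section Episodes

variable {S A : Type*} {H : ℕ}

/-- An episode is a pair of a state sequence and an action sequence. -/
def episodeEquiv : Episode S A H ≃ (Fin (H + 1) → S) × (Fin H → A) where
  toFun e := (e.state, e.action)
  invFun q := ⟨q.1, q.2⟩
  left_inv _ := rfl
  right_inv _ := rfl

noncomputable instance [Fintype S] [Fintype A] : Fintype (Episode S A H) :=
  open scoped Classical in Fintype.ofEquiv _ episodeEquiv.symm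

variable [Fintype S] [Fintype A] {M : ℕ} {y : Fin H → ℕ}
  (mdp : CMDP S A H M) (pol : PolicyClass S A y) (θ : Param y)

theorem sum_episode (F : Episode S A H → ℝ) :
    ∑ e, F e = ∑ st, ∑ ac, F ⟨st, ac⟩ := by
  classical
  rw [← Fintype.sum_prod_type', ← episodeEquiv.symm.sum_comp]
  rfl

theorem sum_policy_mul_transition (h : Fin H) (s : S) :
    ∑ a, ∑ s', pol.μ h (θ h) s a * mdp.p h s a s' = 1 := by
  simp only [← Finset.mul_sum, mdp.p_sum, mul_one, pol.μ_sum]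

theorem stateDist_succ (h : Fin H) (s' : S) :
    stateDist mdp pol θ h.succ s' =
      ∑ s, stateDist mdp pol θ h.castSucc s * ∑ a, pol.μ h (θ h) s a * mdp.p h s a s' := rfl

theorem sum_episodeProb_mul_state (h : Fin (H + 1)) (f : S → ℝ) :
    ∑ e, episodeProb mdp pol θ e * f (e.state h) = ∑ s, stateDist mdp pol θ h s * f s := by
  rw [sum_episode]
  exact sum_pathWeight_mul_state mdp.β (fun h s a s' => pol.μ h (θ h) s a * mdp.p h s a s')
    (sum_policy_mul_transition mdp pol θ) h f

theorem sum_episodeProb_mul_step (h : Fin H) (f : S → A → S → ℝ) :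
    ∑ e, episodeProb mdp pol θ e * f (e.state h.castSucc) (e.action h) (e.state h.succ) =
      ∑ s, stateDist mdp pol θ h.castSucc s *
        ∑ a, ∑ s', pol.μ h (θ h) s a * mdp.p h s a s' * f s a s' := by
  rw [sum_episode]
  exact sum_pathWeight_mul_step mdp.β (fun h s a s' => pol.μ h (θ h) s a * mdp.p h s a s')
    (sum_policy_mul_transition mdp pol θ) h f

theorem episodeProb_nonneg (e : Episode S A H) : 0 ≤ episodeProb mdp pol θ e :=
  mul_nonneg (mdp.β_nonneg _) (Finset.prod_nonneg fun _ _ =>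
    mul_nonneg (pol.μ_pos _ _ _ _).le (mdp.p_nonneg _ _ _ _))

theorem stateDist_nonneg (h : Fin (H + 1)) (s : S) : 0 ≤ stateDist mdp pol θ h s := by
  induction h using Fin.induction generalizing s with
  | zero => exact mdp.β_nonneg s
  | succ i ih =>
    rw [stateDist_succ]
    exact Finset.sum_nonneg fun s' _ => mul_nonneg (ih s') (Finset.sum_nonneg fun a _ =>
      mul_nonneg (pol.μ_pos _ _ _ _).le (mdp.p_nonneg _ _ _ _))

/-- Unvisited states carry zero weight. Summing over all of `S` removes the index type depending on
`θ`, which makes smoothness in `θ` accessible. -/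
theorem sum_visited (h : Fin (H + 1)) (f : S → ℝ) [Fintype (Visited mdp pol θ h)] :
    ∑ s : Visited mdp pol θ h, stateDist mdp pol θ h s * f s =
      ∑ s, stateDist mdp pol θ h s * f s := by
  refine Finset.sum_bij_ne_zero (fun s _ _ => s.1) (fun _ _ _ => Finset.mem_univ _)
    (fun _ _ _ _ _ _ => Subtype.ext) (fun s _ hs => ?_) (fun _ _ _ => rfl)
  have h0 : stateDist mdp pol θ h s ≠ 0 := left_ne_zero_of_mul hs
  exact ⟨⟨s, (stateDist_nonneg mdp pol θ h s).lt_of_ne' h0⟩, Finset.mem_univ _, hs, rfl⟩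

end Episodes

/-! ### The Gram matrix and the projected Bellman equations -/

section Bellman

variable {S A : Type*} [Fintype S] [Fintype A] {H M : ℕ} {y : Fin H → ℕ}
  {x : Fin (H + 1) → ℕ} (mdp : CMDP S A H M) (pol : PolicyClass S A y)
  (φ : ∀ h, S → Fin (x h) → ℝ) (θ : Param y)

/-- A vanishing sum of nonnegative terms has only zero terms, and the weight of `s` is positive.
Hence restricting the transition matrix to visited successors loses no mass. -/
theorem sum_policy_eq_zero_of_not_visited (h : Fin H) (s : Visited mdp pol θ h.castSucc) {s' : S}
    (hs' : ¬ 0 < stateDist mdp pol θ h.succ s') :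
    ∑ a, pol.μ h (θ h) s a * mdp.p h s a s' = 0 := by
  have h0 : stateDist mdp pol θ h.succ s' = 0 :=
    le_antisymm (not_lt.1 hs') (stateDist_nonneg _ _ _ _ _)
  have hn : ∀ s, 0 ≤ ∑ a, pol.μ h (θ h) s a * mdp.p h s a s' := fun s =>
    Finset.sum_nonneg fun a _ => mul_nonneg (pol.μ_pos _ _ _ _).le (mdp.p_nonneg _ _ _ _)
  rw [stateDist_succ, Finset.sum_eq_zero_iff_of_nonneg
    fun s _ => mul_nonneg (stateDist_nonneg _ _ _ _ _) (hn s)] at h0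
  exact (mul_eq_zero.1 (h0 s (Finset.mem_univ _))).resolve_left s.2.ne'

variable (c : Fin H → S → A → S → ℝ) (cT : S → ℝ)

/-- Conditional expectation of `c_h + uᵀ φ_{h+1}` given the current state. -/
noncomputable def bellmanTarget (h : Fin H) (u : Fin (x h.succ) → ℝ) (s : S) : ℝ :=
  ∑ a, ∑ s', pol.μ h (θ h) s a * mdp.p h s a s' * (c h s a s' + u ⬝ᵥ φ h.succ s')

theorem transMatrix_mulVec_add_meanCost (h : Fin H) (u : Fin (x h.succ) → ℝ)
    (s : Visited mdp pol θ h.castSucc) :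
    (transMatrix mdp pol θ h *ᵥ (featureMatrix mdp pol φ θ h.succ *ᵥ u) +
      meanCost mdp pol c θ h) s = bellmanTarget mdp pol φ θ c h u s := by
  have h1 : (transMatrix mdp pol θ h *ᵥ (featureMatrix mdp pol φ θ h.succ *ᵥ u)) s =
      ∑ s', (∑ a, pol.μ h (θ h) s a * mdp.p h s a s') * (u ⬝ᵥ φ h.succ s') := by
    refine Finset.sum_bij_ne_zero (fun s _ _ => s.1) (fun _ _ _ => Finset.mem_univ _)
      (fun _ _ _ _ _ _ => Subtype.ext) (fun s' _ hs' => ?_) (fun s' _ _ => ?_)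
    · have hv : 0 < stateDist mdp pol θ h.succ s' := by
        by_contra hv
        exact left_ne_zero_of_mul hs' (sum_policy_eq_zero_of_not_visited mdp pol θ h s hv)
      refine ⟨⟨s', hv⟩, Finset.mem_univ _, ?_, rfl⟩
      rw [dotProduct_comm] at hs'
      exact hs'
    · rw [dotProduct_comm]; rfl
  rw [Pi.add_apply, h1, meanCost, bellmanTarget]
  simp only [mul_add, Finset.sum_add_distrib, Finset.mul_sum, Finset.sum_mul, mul_assoc]
  rw [Finset.sum_comm, add_comm]

variable {φ θ}

theorem sum_stateDist_mul_sq_pos {h : Fin (H + 1)}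
    (hφ : LinearIndependent ℝ (fun k => (featureMatrix mdp pol φ θ h).col k))
    {z : Fin (x h) → ℝ} (hz : z ≠ 0) :
    0 < ∑ s, stateDist mdp pol θ h s * (z ⬝ᵥ φ h s) ^ 2 := by
  have hne : featureMatrix mdp pol φ θ h *ᵥ z ≠ 0 := fun h0 =>
    hz (Matrix.mulVec_injective_iff.2 hφ (h0.trans (Matrix.mulVec_zero _).symm))
  obtain ⟨s, hs⟩ := Function.ne_iff.1 hne
  have hs' : z ⬝ᵥ φ h s ≠ 0 := fun h0 => hs (by
    rw [dotProduct_comm] at h0; exact h0)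
  exact Finset.sum_pos' (fun s _ => mul_nonneg (stateDist_nonneg _ _ _ _ _) (sq_nonneg _))
    ⟨s, Finset.mem_univ _, mul_pos s.2 (by positivity)⟩

variable (φ θ) [DecidableEq S]

theorem featureMatrix_transpose_mul_distMatrix_mulVec (h : Fin (H + 1)) (f : S → ℝ)
    (w : Visited mdp pol θ h → ℝ) (hw : ∀ s, w s = f s) (i : Fin (x h)) :
    (((featureMatrix mdp pol φ θ h)ᵀ * distMatrix mdp pol θ h) *ᵥ w) i =
      ∑ s, stateDist mdp pol θ h s * (f s * φ h s i) := by
  rw [← sum_visited]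
  simp only [Matrix.mulVec, dotProduct, distMatrix, Matrix.mul_diagonal, Matrix.transpose_apply,
    featureMatrix, Matrix.of_apply, hw]
  exact Finset.sum_congr rfl fun s _ => by ring

theorem gram_apply (h : Fin (H + 1)) (i j : Fin (x h)) :
    gram mdp pol φ θ h i j = ∑ s, stateDist mdp pol θ h s * (φ h s j * φ h s i) :=
  featureMatrix_transpose_mul_distMatrix_mulVec mdp pol φ θ h (fun s => φ h s j)
    (fun s => φ h s j) (fun _ => rfl) i

theorem gram_mulVec (h : Fin (H + 1)) (z : Fin (x h) → ℝ) (i : Fin (x h)) :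
    (gram mdp pol φ θ h *ᵥ z) i =
      ∑ s, stateDist mdp pol θ h s * ((z ⬝ᵥ φ h s) * φ h s i) := by
  simp only [Matrix.mulVec, dotProduct, gram_apply, Finset.sum_mul, Finset.mul_sum]
  rw [Finset.sum_comm]
  exact Finset.sum_congr rfl fun s _ => Finset.sum_congr rfl fun j _ => by ring

variable {φ θ}

/-- The quadratic form of the Gram matrix at `z` is the `d`-weighted sum of the squares `(z ⬝ᵥ φ h
s) ^ 2`, positive for `z ≠ 0`; so the kernel is trivial. -/
theorem isUnit_gram {h : Fin (H + 1)}
    (hφ : LinearIndependent ℝ (fun k => (featureMatrix mdp pol φ θ h).col k)) :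
    IsUnit (gram mdp pol φ θ h) := by
  rw [← Matrix.mulVec_injective_iff_isUnit]
  refine (injective_iff_map_eq_zero (gram mdp pol φ θ h).mulVecLin).2 fun z hz => ?_
  by_contra hne
  refine (sum_stateDist_mul_sq_pos mdp pol hφ hne).ne' ?_
  have h0 : z ⬝ᵥ (gram mdp pol φ θ h *ᵥ z) = 0 := by
    rw [Matrix.mulVecLin_apply] at hz; rw [hz, dotProduct_zero]
  rw [← h0]
  simp only [dotProduct, gram_mulVec, Finset.mul_sum]
  rw [Finset.sum_comm]
  refine Finset.sum_congr rfl fun s _ => ?_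
  rw [sq, Finset.mul_sum, Finset.mul_sum]
  exact Finset.sum_congr rfl fun j _ => by ring

variable (φ θ)

theorem bellman_rhs_apply (h : Fin H) (u : Fin (x h.succ) → ℝ) (i : Fin (x h.castSucc)) :
    (((featureMatrix mdp pol φ θ h.castSucc)ᵀ * distMatrix mdp pol θ h.castSucc *
        transMatrix mdp pol θ h * featureMatrix mdp pol φ θ h.succ) *ᵥ u
      + ((featureMatrix mdp pol φ θ h.castSucc)ᵀ * distMatrix mdp pol θ h.castSucc) *ᵥ
          meanCost mdp pol c θ h) i =
      ∑ s, stateDist mdp pol θ h.castSucc s *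
        (bellmanTarget mdp pol φ θ c h u s * φ h.castSucc s i) := by
  rw [← featureMatrix_transpose_mul_distMatrix_mulVec mdp pol φ θ h.castSucc _ _
    (transMatrix_mulVec_add_meanCost mdp pol φ θ c h u) i, Matrix.mulVec_add,
    Matrix.mulVec_mulVec, Matrix.mulVec_mulVec]

theorem projectedBellman_last :
    projectedBellman mdp pol φ c cT θ (Fin.last H) = (gram mdp pol φ θ (Fin.last H))⁻¹ *ᵥ
      fun i => ∑ s, stateDist mdp pol θ (Fin.last H) s * (cT s * φ (Fin.last H) s i) := by
  rw [projectedBellman, Fin.reverseInduction_last]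
  congr 1
  ext i
  exact featureMatrix_transpose_mul_distMatrix_mulVec mdp pol φ θ _ cT _ (fun _ => rfl) i

theorem projectedBellman_castSucc (h : Fin H) :
    projectedBellman mdp pol φ c cT θ h.castSucc = (gram mdp pol φ θ h.castSucc)⁻¹ *ᵥ
      fun i => ∑ s, stateDist mdp pol θ h.castSucc s *
        (bellmanTarget mdp pol φ θ c h (projectedBellman mdp pol φ c cT θ h.succ) s *
          φ h.castSucc s i) := by
  conv_lhs => rw [projectedBellman, Fin.reverseInduction_castSucc]
  congr 1
  ext i
  exact bellman_rhs_apply mdp pol φ θ c h _ i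

variable {φ θ}

theorem gram_mulVec_projectedBellman_last
    (hφ : LinearIndependent ℝ (fun k => (featureMatrix mdp pol φ θ (Fin.last H)).col k))
    (i : Fin (x (Fin.last H))) :
    (gram mdp pol φ θ (Fin.last H) *ᵥ projectedBellman mdp pol φ c cT θ (Fin.last H)) i =
      ∑ s, stateDist mdp pol θ (Fin.last H) s * (cT s * φ (Fin.last H) s i) := by
  rw [projectedBellman_last, Matrix.mulVec_mulVec,
    Matrix.mul_nonsing_inv _ ((Matrix.isUnit_iff_isUnit_det _).1 (isUnit_gram mdp pol hφ)),
    Matrix.one_mulVec]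

theorem gram_mulVec_projectedBellman_castSucc (h : Fin H)
    (hφ : LinearIndependent ℝ (fun k => (featureMatrix mdp pol φ θ h.castSucc).col k))
    (i : Fin (x h.castSucc)) :
    (gram mdp pol φ θ h.castSucc *ᵥ projectedBellman mdp pol φ c cT θ h.castSucc) i =
      ∑ s, stateDist mdp pol θ h.castSucc s *
        (bellmanTarget mdp pol φ θ c h (projectedBellman mdp pol φ c cT θ h.succ) s *
          φ h.castSucc s i) := by
  rw [projectedBellman_castSucc, Matrix.mulVec_mulVec,
    Matrix.mul_nonsing_inv _ ((Matrix.isUnit_iff_isUnit_det _).1 (isUnit_gram mdp pol hφ)),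
    Matrix.one_mulVec]

/-- The mean terminal TD increment vanishes at the solution of the projected equations. -/
theorem sum_episodeProb_tdIncrement_last
    (hφ : LinearIndependent ℝ (fun k => (featureMatrix mdp pol φ θ (Fin.last H)).col k))
    (i : Fin (x (Fin.last H))) :
    ∑ e : Episode S A H, episodeProb mdp pol θ e * ((cT (e.state (Fin.last H)) -
      projectedBellman mdp pol φ c cT θ (Fin.last H) ⬝ᵥ φ (Fin.last H) (e.state (Fin.last H))) *
        φ (Fin.last H) (e.state (Fin.last H)) i) = 0 := by
  rw [sum_episodeProb_mul_state mdp pol θ (Fin.last H) fun s => (cT s -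
    projectedBellman mdp pol φ c cT θ (Fin.last H) ⬝ᵥ φ (Fin.last H) s) * φ (Fin.last H) s i]
  simp only [sub_mul, mul_sub, Finset.sum_sub_distrib, ← gram_mulVec]
  rw [gram_mulVec_projectedBellman_last mdp pol c cT hφ, sub_self]

/-- The mean TD increment vanishes at the solution of the projected equations. -/
theorem sum_episodeProb_tdIncrement_castSucc (h : Fin H)
    (hφ : LinearIndependent ℝ (fun k => (featureMatrix mdp pol φ θ h.castSucc).col k))
    (i : Fin (x h.castSucc)) :
    ∑ e : Episode S A H, episodeProb mdp pol θ e *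
      ((c h (e.state h.castSucc) (e.action h) (e.state h.succ) +
        projectedBellman mdp pol φ c cT θ h.succ ⬝ᵥ φ h.succ (e.state h.succ) -
        projectedBellman mdp pol φ c cT θ h.castSucc ⬝ᵥ φ h.castSucc (e.state h.castSucc)) *
        φ h.castSucc (e.state h.castSucc) i) = 0 := by
  rw [sum_episodeProb_mul_step mdp pol θ h fun s a s' => (c h s a s' +
    projectedBellman mdp pol φ c cT θ h.succ ⬝ᵥ φ h.succ s' -
    projectedBellman mdp pol φ c cT θ h.castSucc ⬝ᵥ φ h.castSucc s) * φ h.castSucc s i]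
  have h1 := gram_mulVec_projectedBellman_castSucc mdp pol c cT h hφ i
  rw [gram_mulVec, ← sub_eq_zero, ← Finset.sum_sub_distrib] at h1
  rw [← neg_eq_zero, ← h1, ← Finset.sum_neg_distrib]
  refine Finset.sum_congr rfl fun s _ => ?_
  simp only [sub_mul, mul_sub, Finset.sum_sub_distrib, ← Finset.sum_mul, ← mul_assoc,
    sum_policy_mul_transition, one_mul, bellmanTarget]
  ring

end Bellman

/-! ### Least-mean-squares recursions with finitely valued noise -/

section FiniteNoise

variable {X : Type*} [Fintype X] {q : X → ℝ} {a : ℕ → ℝ} {ep : ℕ → X}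

/-- If the weighted fluctuations of the empirical measure converge, so do those of every
vector-valued observable. -/
theorem exists_tendsto_sum_smul_sub_mean {V : Type*} [NormedAddCommGroup V] [NormedSpace ℝ V]
    (hconv : ∀ e, ∃ l, Tendsto
      (fun n => ∑ i ∈ Finset.range n, a i * (Set.indicator {e} 1 (ep i) - q e)) atTop (𝓝 l))
    (F : X → V) :
    ∃ l, Tendsto (fun n => ∑ i ∈ Finset.range n, a i • (F (ep i) - ∑ e, q e • F e)) atTop
      (𝓝 l) := by
  choose l hl using hconv
  refine ⟨∑ e, l e • F e, (tendsto_finsetSum _ fun e _ => (hl e).smul_const (F e)).congr ?_⟩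
  intro n
  simp only [Finset.sum_smul]
  rw [Finset.sum_comm]
  refine Finset.sum_congr rfl fun i _ => ?_
  simp only [mul_smul, sub_smul, ← Finset.smul_sum, Finset.sum_sub_distrib]
  congr 2
  rw [Finset.sum_eq_single (ep i) (fun e _ he => ?_) fun h => absurd (Finset.mem_univ _) h]
  · simp
  · simp [he.symm]

/-- The minimum of the quadratic form on the compact unit sphere serves as `κ`, by homogeneity. The
trivial space, where the sphere is empty, is treated apart. -/
theorem exists_coercive {E : Type*} [NormedAddCommGroup E] [InnerProductSpace ℝ E]
    [FiniteDimensional ℝ E] {B : E →L[ℝ] E} (hB : ∀ z ≠ 0, 0 < inner ℝ (B z) z) :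
    ∃ κ > 0, ∀ z, κ * ‖z‖ ^ 2 ≤ inner ℝ (B z) z := by
  rcases subsingleton_or_nontrivial E with hE | hE
  · exact ⟨1, one_pos, fun z => by simp [Subsingleton.elim z 0]⟩
  have hc : Continuous fun z => inner ℝ (B z) z := by fun_prop
  obtain ⟨z₀, hz₀, hmin⟩ := (isCompact_sphere (0 : E) 1).exists_isMinOn
    (NormedSpace.sphere_nonempty.2 zero_le_one) hc.continuousOn
  have hz₀' : z₀ ≠ 0 := by rintro rfl; simp at hz₀
  refine ⟨_, hB z₀ hz₀', fun z => ?_⟩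
  rcases eq_or_ne z 0 with rfl | hz
  · simp
  have hz' : ‖z‖ ≠ 0 := norm_ne_zero_iff.2 hz
  have h1 := isMinOn_iff.1 hmin (‖z‖⁻¹ • z) (by simp [norm_smul, hz'])
  simp only [map_smul, real_inner_smul_left, real_inner_smul_right] at h1
  calc inner ℝ (B z₀) z₀ * ‖z‖ ^ 2 ≤ ‖z‖⁻¹ * (‖z‖⁻¹ * inner ℝ (B z) z) * ‖z‖ ^ 2 := by gcongr
    _ = inner ℝ (B z) z := by field_simp

/-- Convergence to zero of a least-mean-squares recursion driven by a trajectory whose weighted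
empirical fluctuations converge. -/
theorem tendsto_zero_of_lms_recursion {E : Type*} [NormedAddCommGroup E] [InnerProductSpace ℝ E]
    [FiniteDimensional ℝ E] (ha : ∀ n, 0 < a n) (ha0 : Tendsto a atTop (𝓝 0))
    (has : Tendsto (fun n => ∑ i ∈ Finset.range n, a i) atTop atTop)
    (hconv : ∀ e, ∃ l, Tendsto
      (fun n => ∑ i ∈ Finset.range n, a i * (Set.indicator {e} 1 (ep i) - q e)) atTop (𝓝 l))
    {ψ η : X → E} (hψ : ∀ z ≠ 0, 0 < ∑ e, q e * inner ℝ (ψ e) z ^ 2)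
    (hη : ∑ e, q e • η e = 0) {b u : ℕ → E} (hb : Tendsto b atTop (𝓝 0))
    (hu : ∀ n, u (n + 1) =
      u n + a n • (-(inner ℝ (ψ (ep n)) (u n) • ψ (ep n)) + η (ep n) + b n)) :
    Tendsto u atTop (𝓝 0) := by
  set F : X → E →L[ℝ] E := fun e => InnerProductSpace.rankOne ℝ (ψ e) (ψ e) with hF
  obtain ⟨R, hR⟩ := exists_tendsto_sum_smul_sub_mean hconv F
  obtain ⟨r, hr⟩ := exists_tendsto_sum_smul_sub_mean hconv η
  simp only [hη, sub_zero] at hr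
  -- The mean of the rank-one operators has the weighted sum of squares in `hψ` as its quadratic
  -- form.
  have hpos : ∀ z ≠ 0, 0 < inner ℝ ((∑ e, q e • F e) z) z := fun z hz => by
    refine (hψ z hz).trans_eq ?_
    simp only [hF, sum_apply, sum_inner, smul_apply,
      real_inner_smul_left, InnerProductSpace.rankOne_apply, sq]
  obtain ⟨κ, hκ0, hκ⟩ := exists_coercive hpos
  refine tendsto_zero_of_linear_recursion ha ha0 has hκ0 hκ
    (Bn := fun n => F (ep n)) (ξ := fun n => η (ep n)) (C := ∑ e, (‖F e‖ + ‖η e‖)) (fun n => ?_)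
    (fun n => ?_) hb hR hr fun n => ?_
  · exact (le_add_of_nonneg_right (norm_nonneg _)).trans
      (Finset.single_le_sum (f := fun e => ‖F e‖ + ‖η e‖) (fun e _ => by positivity)
        (Finset.mem_univ (ep n)))
  · exact (le_add_of_nonneg_left (norm_nonneg _)).trans
      (Finset.single_le_sum (f := fun e => ‖F e‖ + ‖η e‖) (fun e _ => by positivity)
        (Finset.mem_univ (ep n)))
  · rw [hu n]
    simp only [hF, InnerProductSpace.rankOne_apply]

/-- Coordinate version of `tendsto_zero_of_lms_recursion`, for the error `v - Λ` of a recursion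
whose noise has mean zero at `Λ` and which is perturbed by a vanishing scalar `b n (ep n)`. -/
theorem tendsto_of_lms_recursion_pi {d : ℕ} (ha : ∀ n, 0 < a n) (ha0 : Tendsto a atTop (𝓝 0))
    (has : Tendsto (fun n => ∑ i ∈ Finset.range n, a i) atTop atTop)
    (hconv : ∀ e, ∃ l, Tendsto
      (fun n => ∑ i ∈ Finset.range n, a i * (Set.indicator {e} 1 (ep i) - q e)) atTop (𝓝 l))
    {ψ : X → Fin d → ℝ} (hψ : ∀ z : Fin d → ℝ, z ≠ 0 → 0 < ∑ e, q e * (z ⬝ᵥ ψ e) ^ 2)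
    {f : X → ℝ} {L : Fin d → ℝ} (hf : ∀ i, ∑ e, q e * ((f e - L ⬝ᵥ ψ e) * ψ e i) = 0)
    {b : ℕ → X → ℝ} (hb : ∀ e, Tendsto (fun n => b n e) atTop (𝓝 0)) {v : ℕ → Fin d → ℝ}
    (hv : ∀ n, v (n + 1) =
      v n + (a n * (f (ep n) + b n (ep n) - v n ⬝ᵥ ψ (ep n))) • ψ (ep n)) :
    Tendsto v atTop (𝓝 L) := by
  have key : Tendsto (fun n => WithLp.toLp 2 (v n - L)) atTop
      (𝓝 (0 : EuclideanSpace ℝ (Fin d))) := by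
    refine tendsto_zero_of_lms_recursion (ψ := fun e => WithLp.toLp 2 (ψ e))
      (η := fun e => WithLp.toLp 2 ((f e - L ⬝ᵥ ψ e) • ψ e))
      (b := fun n => WithLp.toLp 2 (b n (ep n) • ψ (ep n)))
      ha ha0 has hconv (fun z hz => ?_) ?_ ?_ fun n => ?_
    · have hz' : z.ofLp ≠ 0 := fun h => hz (by ext i; exact congrFun h i)
      refine (hψ _ hz').trans_eq ?_
      simp [EuclideanSpace.inner_eq_star_dotProduct]
    · ext i
      simpa using hf i
    -- The perturbation is evaluated at the random `ep n`; the sum over all of the finite space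
    -- dominates it.
    · have hlim : Tendsto (fun n => ∑ e, ‖WithLp.toLp 2 (b n e • ψ e)‖) atTop (𝓝 0) := by
        have h1 : ∀ e, Tendsto (fun n => ‖WithLp.toLp 2 (b n e • ψ e)‖) atTop (𝓝 0) := fun e => by
          have h2 := ((hb e).smul_const (WithLp.toLp 2 (ψ e))).norm
          rw [zero_smul, norm_zero] at h2
          exact h2
        simpa using tendsto_finsetSum Finset.univ fun e _ => h1 e
      exact squeeze_zero_norm (fun n => Finset.single_le_sum
        (f := fun e => ‖WithLp.toLp 2 (b n e • ψ e)‖) (fun e _ => norm_nonneg _)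
        (Finset.mem_univ (ep n))) hlim
    · ext i
      simp only [hv n, EuclideanSpace.inner_eq_star_dotProduct, sub_dotProduct, star_trivial,
        PiLp.add_apply, PiLp.smul_apply, PiLp.neg_apply, Pi.add_apply, Pi.sub_apply, Pi.smul_apply,
        smul_eq_mul]
      ring
  have h1 := ((PiLp.continuous_ofLp 2 fun _ : Fin d => ℝ).tendsto _).comp key
  simpa using h1.add_const L

end FiniteNoise

/-! ### Backward induction for the TD critic -/

section Critic

variable {S A : Type*} [Fintype S] [DecidableEq S] [Fintype A] {H M : ℕ} {y : Fin H → ℕ}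
  {x : Fin (H + 1) → ℕ}

/-- Convergence of the TD critic along a fixed sequence of episodes whose weighted empirical
fluctuations converge. -/
theorem tendsto_tdCritic (mdp : CMDP S A H M) (pol : PolicyClass S A y)
    (φ : ∀ h, S → Fin (x h) → ℝ) (θ : Param y)
    (hφ : ∀ h, LinearIndependent ℝ (fun k => (featureMatrix mdp pol φ θ h).col k))
    (c : Fin H → S → A → S → ℝ) (cT : S → ℝ)
    {a : ℕ → ℝ} {ep : ℕ → Episode S A H} (ha : ∀ n, 0 < a n) (ha0 : Tendsto a atTop (𝓝 0))
    (has : Tendsto (fun n => ∑ i ∈ Finset.range n, a i) atTop atTop)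
    (hconv : ∀ e, ∃ l, Tendsto
      (fun n => ∑ i ∈ Finset.range n,
        a i * (Set.indicator {e} 1 (ep i) - episodeProb mdp pol θ e)) atTop (𝓝 l))
    (v₀ : ∀ h, Fin (x h) → ℝ) (h : Fin (H + 1)) :
    Tendsto (fun n => tdCritic φ c cT a ep v₀ n h) atTop
      (𝓝 (projectedBellman mdp pol φ c cT θ h)) := by
  have hψ : ∀ h, ∀ z : Fin (x h) → ℝ, z ≠ 0 →
      0 < ∑ e : Episode S A H, episodeProb mdp pol θ e * (z ⬝ᵥ φ h (e.state h)) ^ 2 :=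
    fun h z hz => by
      rw [sum_episodeProb_mul_state mdp pol θ h fun s => (z ⬝ᵥ φ h s) ^ 2]
      exact sum_stateDist_mul_sq_pos mdp pol (hφ h) hz
  induction h using Fin.reverseInduction with
  | last =>
    refine tendsto_of_lms_recursion_pi ha ha0 has hconv (hψ _)
      (sum_episodeProb_tdIncrement_last mdp pol c cT (hφ _)) (b := fun _ _ => 0)
      (fun _ => tendsto_const_nhds) fun n => ?_
    simp only [tdCritic, tdStep, Fin.lastCases_last, add_zero]
  | cast h ih =>
    refine tendsto_of_lms_recursion_pi ha ha0 has hconv (hψ _)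
      (sum_episodeProb_tdIncrement_castSucc mdp pol c cT h (hφ _))
      -- The limit of stage `h + 1` is put into the target, so the perturbation is the current error
      -- of that stage, which vanishes by `ih`.
      (b := fun n e => (tdCritic φ c cT a ep v₀ n h.succ -
        projectedBellman mdp pol φ c cT θ h.succ) ⬝ᵥ φ h.succ (e.state h.succ))
      (fun e => ?_) fun n => ?_
    · have h1 := ih.sub_const (projectedBellman mdp pol φ c cT θ h.succ)
      rw [sub_self] at h1
      have h2 : Continuous fun w : Fin (x h.succ) → ℝ => w ⬝ᵥ φ h.succ (e.state h.succ) := by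
        unfold dotProduct; fun_prop
      have h3 := (h2.tendsto 0).comp h1
      rw [zero_dotProduct] at h3
      exact h3
    · conv_lhs => rw [tdCritic, tdStep, Fin.lastCases_castSucc]
      rw [sub_dotProduct]
      congr 3
      ring

end Critic

/-! ### Smooth dependence on the parameters -/

section Smoothness

variable {V : Type*} [NormedAddCommGroup V] [NormedSpace ℝ V]

theorem contDiff_matrix_det {d : ℕ} {A : V → Matrix (Fin d) (Fin d) ℝ}
    (hA : ∀ i j, ContDiff ℝ 1 fun q => A q i j) : ContDiff ℝ 1 fun q => (A q).det := by
  simp only [Matrix.det_apply]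
  exact ContDiff.sum fun σ _ => (contDiff_prod fun i _ => hA _ _).const_smul _

/-- By Cramer's rule the inverse is the adjugate over the determinant: its entries are quotients of
polynomials in the entries of `A`, with nonvanishing denominator. -/
theorem contDiff_inv_mulVec {d : ℕ} {A : V → Matrix (Fin d) (Fin d) ℝ} {b : V → Fin d → ℝ}
    (hA : ∀ i j, ContDiff ℝ 1 fun q => A q i j) (hb : ∀ i, ContDiff ℝ 1 fun q => b q i)
    (hu : ∀ q, IsUnit (A q)) : ContDiff ℝ 1 fun q => (A q)⁻¹ *ᵥ b q := by
  refine contDiff_pi' fun i => ?_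
  simp only [Matrix.mulVec, dotProduct, Matrix.inv_def, Matrix.smul_apply, Ring.inverse_eq_inv',
    smul_eq_mul, Matrix.adjugate_apply]
  refine ContDiff.sum fun j _ => ContDiff.mul (ContDiff.mul ?_ ?_) (hb j)
  · exact (contDiff_matrix_det hA).inv fun q => ((Matrix.isUnit_iff_isUnit_det _).1 (hu q)).ne_zero
  · refine contDiff_matrix_det fun k l => ?_
    simp only [Matrix.updateRow_apply]
    split_ifs
    · exact contDiff_const
    · exact hA _ _

/-- Compactness upgrades the local Lipschitz property of a C¹ map; `s` need not be convex. -/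
theorem exists_lipschitzOnWith_of_contDiff {W : Type*} [NormedAddCommGroup W] [NormedSpace ℝ W]
    {f : V → W} (hf : ContDiff ℝ 1 f) {s : Set V} (hs : IsCompact s) :
    ∃ K, LipschitzOnWith K f s :=
  LocallyLipschitzOn.exists_lipschitzOnWith_of_compact hs hf.locallyLipschitz.locallyLipschitzOn

variable {S A : Type*} [Fintype A] {H M : ℕ} {y : Fin H → ℕ} {x : Fin (H + 1) → ℕ}

theorem contDiff_policy (pol : PolicyClass S A y) {θ : V → Param y}
    (hθ : ContDiff ℝ 1 θ) (h : Fin H) (s : S) (a : A) :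
    ContDiff ℝ 1 fun q => pol.μ h (θ q h) s a :=
  ((pol.μ_contDiff h s a).of_le one_le_two).comp (contDiff_pi.1 hθ h)

variable [Fintype S] (mdp : CMDP S A H M) (pol : PolicyClass S A y) {θ : V → Param y}

theorem contDiff_stateDist (hθ : ContDiff ℝ 1 θ) (h : Fin (H + 1)) (s : S) :
    ContDiff ℝ 1 fun q => stateDist mdp pol (θ q) h s := by
  induction h using Fin.induction generalizing s with
  | zero => exact contDiff_const
  | succ i ih =>
    simp only [stateDist_succ]
    exact ContDiff.sum fun s' _ => (ih s').mul
      (ContDiff.sum fun a _ => (contDiff_policy pol hθ i s' a).mul contDiff_const)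

/-- The solution of the projected equations is continuously differentiable in the policy
parameter and in any parameter on which the costs depend differentiably. -/
theorem contDiff_projectedBellman [DecidableEq S] (hθ : ContDiff ℝ 1 θ)
    (φ : ∀ h, S → Fin (x h) → ℝ)
    (hφ : ∀ (θ : Param y) h, LinearIndependent ℝ (fun k => (featureMatrix mdp pol φ θ h).col k))
    {c : V → Fin H → S → A → S → ℝ} {cT : V → S → ℝ}
    (hc : ∀ h s a s', ContDiff ℝ 1 fun q => c q h s a s') (hcT : ∀ s, ContDiff ℝ 1 fun q => cT q s)
    (h : Fin (H + 1)) :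
    ContDiff ℝ 1 fun q => projectedBellman mdp pol φ (c q) (cT q) (θ q) h := by
  have hgram : ∀ h i j, ContDiff ℝ 1 fun q => gram mdp pol φ (θ q) h i j := fun h i j => by
    simp only [gram_apply]
    exact ContDiff.sum fun s _ => (contDiff_stateDist mdp pol hθ h s).mul contDiff_const
  induction h using Fin.reverseInduction with
  | last =>
    simp only [projectedBellman_last]
    exact contDiff_inv_mulVec (hgram _)
      (fun i => ContDiff.sum fun s _ => (contDiff_stateDist mdp pol hθ _ s).mul
        ((hcT s).mul contDiff_const)) fun q => isUnit_gram mdp pol (hφ _ _)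
  | cast h ih =>
    simp only [projectedBellman_castSucc]
    refine contDiff_inv_mulVec (hgram _)
      (fun i => ContDiff.sum fun s _ => (contDiff_stateDist mdp pol hθ _ s).mul
        (ContDiff.mul ?_ contDiff_const)) fun q => isUnit_gram mdp pol (hφ _ _)
    simp only [bellmanTarget]
    refine ContDiff.sum fun a _ => ContDiff.sum fun s' _ =>
      ((contDiff_policy pol hθ h s a).mul contDiff_const).mul ((hc h s a s').add ?_)
    simp only [dotProduct]
    exact ContDiff.sum fun k _ => (contDiff_pi.1 ih k).mul contDiff_const

end Smoothness

end FiniteHorizon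

/-! ### The main theorem -/

open FiniteHorizon in
theorem theorem2 {S A : Type*} [Fintype S] [DecidableEq S] [Fintype A] {H M : ℕ}
    {y : Fin H → ℕ} {x : Fin (H + 1) → ℕ}
    (mdp : CMDP S A H M) (pol : PolicyClass S A y) (φ : ∀ h : Fin (H + 1), S → Fin (x h) → ℝ)
    -- the basis functions (columns of `Φ_h`) are linearly independent on `S_h`
    (hφ : ∀ (θ : Param y) (h : Fin (H + 1)),
      LinearIndependent ℝ (fun k => (featureMatrix mdp pol φ θ h).col k)) :
    -- the points are well defined
    (∀ (θ : Param y) (h : Fin (H + 1)), IsUnit (gram mdp pol φ θ h)) ∧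
    -- almost sure convergence of the critics for fixed `θ` and `λ`
    (∀ (θ : Param y) (lam : Fin M → ℝ) (a : ℕ → ℝ), (∀ n, 0 < a n) →
      Tendsto (fun n => ∑ i ∈ Finset.range n, a i) atTop atTop →
      Summable (fun n => a n ^ 2) →
      ∀ (Ω : Type*) [MeasurableSpace Ω] (P : Measure Ω) [IsProbabilityMeasure P]
        (ep : ℕ → Ω → Episode S A H), IsEpisodeSequence P mdp pol θ ep →
      ∀ (v₀ : Ω → ∀ h, Fin (x h) → ℝ) (w₀ : Fin M → Ω → ∀ h, Fin (x h) → ℝ),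
        ∀ᵐ ω ∂P,
          (∀ h, Tendsto (fun n => mainCritic mdp φ lam a (fun m => ep m ω) (v₀ ω) n h) atTop
            (𝓝 (mainLimit mdp pol φ θ lam h))) ∧
          ∀ k h, Tendsto
            (fun n => constraintCritic mdp φ k a (fun m => ep m ω) (w₀ k ω) n h) atTop
            (𝓝 (constraintLimit mdp pol φ k θ h))) ∧
    -- Lipschitz continuity in `(θ, λ)` on compact sets
    (∀ (T : Set (Param y)) (L : Set (Fin M → ℝ)), IsCompact T → IsCompact L →
      ∀ h : Fin (H + 1),
        (∃ K, LipschitzOnWith K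
          (fun q : Param y × (Fin M → ℝ) => mainLimit mdp pol φ q.1 q.2 h) (T ×ˢ L)) ∧
        ∀ k, ∃ K, LipschitzOnWith K
          (fun q : Param y × (Fin M → ℝ) => constraintLimit mdp pol φ k q.1 h) (T ×ˢ L)) := by
  refine ⟨fun θ h => isUnit_gram mdp pol (hφ θ h), ?_, fun T L hT hL h => ⟨?_, fun k => ?_⟩⟩
  · intro θ lam a ha has ha2 Ω _ P _ ep hep v₀ w₀
    have ha0 : Tendsto a atTop (𝓝 0) := by
      have h1 := ha2.tendsto_atTop_zero.sqrt
      simpa [Real.sqrt_sq (ha _).le] using h1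
    have : MeasurableSingletonClass (Episode S A H) := ⟨fun _ => trivial⟩
    -- This event involves neither costs nor initial weights, so a single null set serves the main
    -- critic and all constraint critics, even with random initial weights.
    have hconv : ∀ᵐ ω ∂P, ∀ e, ∃ l, Tendsto (fun n => ∑ i ∈ Finset.range n,
        a i * (Set.indicator {e} 1 (ep i ω) - episodeProb mdp pol θ e)) atTop (𝓝 l) :=
      ae_all_iff.2 fun e => ae_exists_tendsto_sum_indicator hep.measurable hep.indep
        (episodeProb_nonneg mdp pol θ e) (fun n => hep.law n e) ha2
    filter_upwards [hconv] with ω hω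
    exact ⟨fun h => tendsto_tdCritic mdp pol φ θ (hφ θ) _ _ ha ha0 has hω _ h,
      fun k h => tendsto_tdCritic mdp pol φ θ (hφ θ) _ _ ha ha0 has hω _ h⟩
  · refine exists_lipschitzOnWith_of_contDiff ?_ (hT.prod hL)
    have hlam : ∀ k, ContDiff ℝ 1 fun q : Param y × (Fin M → ℝ) => q.2 k :=
      fun k => contDiff_pi.1 contDiff_snd k
    exact contDiff_projectedBellman mdp pol contDiff_fst φ hφ
      (c := fun q => lagCost mdp q.2) (cT := fun q => lagTerminal mdp q.2)
      (fun h s a s' => contDiff_const.add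
        (ContDiff.sum fun k _ => (hlam k).mul contDiff_const))
      (fun s => contDiff_const.add (ContDiff.sum fun k _ => (hlam k).mul contDiff_const)) h
  · exact exists_lipschitzOnWith_of_contDiff
      (contDiff_projectedBellman mdp pol contDiff_fst φ hφ (c := fun _ => mdp.g k)
        (cT := fun _ s => mdp.gT k s - mdp.α k) (fun _ _ _ _ => contDiff_const) (fun _ => contDiff_const) h) (hT.prod hL)
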